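/- Let $\mathbb{T}^2=\mathbb{R}^2/\mathbb{Z}^2$ be the flat torus with its normalized Haar (Lebesgue) probability measure $\nu$, and let \[ T_1=\begin{pmatrix}1&2\\0&1\end{pmatrix},\qquad T_2=\begin{pmatrix}1&0\\2&1\end{pmatrix} \] act on $\mathbb{T}^2$ by $x\mapsto Tx \bmod 1$. Let $\mathbb{K}=\mathbb{R}$ or $\mathbb{K}=\mathbb{C}$, let $L^2(\mathbb{T}^2,\nu)$ be the Hilbert space of square-integrable $\mathbb{K}$-valued functions, and let $L^2_0(\mathbb{T}^2,\nu)$ be the orthogonal complement of the constant functions in it. Define the Gabber–Galil–Margulis limit operator $\mathcal{G}$ on $L^2(\mathbb{T}^2,\nu)$ by \[ [\mathcal{G}f](x)=\tfrac14\bigl(f(T_1x)+f(T_1^{-1}x)+f(T_2x)+f(T_2^{-1}x)\bigr). \] The operator $\mathcal{G}$ maps $L^2_0(\mathbb{T}^2,\nu)$ into itself; let $\mathcal{G}_0$ be its restriction to $L^2_0(\mathbb{T}^2,\nu)$. Theorem. (i) $\mathcal{G}$ has no eigenfunctions in $L^2_0(\mathbb{T}^2,\nu)$: if $f\in L^2_0(\mathbb{T}^2,\nu)$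 and $\mathcal{G}f=\lambda f$ for some scalar $\lambda\in\mathbb{K}$, then $f=0$. (ii) The spectrum of $\mathcal{G}_0$ is real and purely continuous: every $\lambda$ in the spectrum of $\mathcal{G}_0$ is real, and the spectrum coincides with the set of all $\lambda\in\mathbb{K}$ for which $\mathcal{G}_0-\lambda$ is injective with dense range but not surjective. (iii) The spectral radius of $\mathcal{G}_0$ is at most $\frac{\sqrt3}{2}$, and $\|\mathcal{G}\|_{\mathcal{L}(L^2_0)}=\|\mathcal{G}_0\|\le\frac{\sqrt3}{2}$. -/

import Mathlib

open MeasureTheory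
open scoped ENNReal MatrixGroups

namespace TorusExpander

noncomputable section

/-- The flat torus `𝕋² = ℝ² / ℤ²`. -/
abbrev Torus : Type := Fin 2 → UnitAddCircle

/-- The normalized Haar (Lebesgue) probability measure `ν` on `𝕋²`. -/
abbrev torusMeasure : Measure Torus :=
  Measure.pi fun _ : Fin 2 => (AddCircle.haarAddCircle : Measure UnitAddCircle)

/-- The matrix `T₁`, with rows `(1, 2)` and `(0, 1)`. -/
def T₁ : SL(2, ℤ) := ⟨!![1, 2; 0, 1], by simp [Matrix.det_fin_two]⟩

/-- The matrix `T₂`, with rows `(1, 0)` and `(2, 1)`. -/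
def T₂ : SL(2, ℤ) := ⟨!![1, 0; 2, 1], by simp [Matrix.det_fin_two]⟩

/-- The transformation `x ↦ A x mod 1` of the torus, for `A ∈ SL(2, ℤ)`, as an additive map. -/
def act (A : SL(2, ℤ)) : Torus →+ Torus where
  toFun x := fun i => ∑ j : Fin 2, (A : Matrix (Fin 2) (Fin 2) ℤ) i j • x j
  map_zero' := by ext i; simp
  map_add' x y := by ext i; simp [smul_add, Finset.sum_add_distrib]

theorem act_apply (A : SL(2, ℤ)) (x : Torus) (i : Fin 2) :
    act A x i = ∑ j : Fin 2, (A : Matrix (Fin 2) (Fin 2) ℤ) i j • x j := rfl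

theorem act_one (x : Torus) : act 1 x = x := by
  ext i
  fin_cases i <;> simp [act_apply]

theorem act_mul (A B : SL(2, ℤ)) (x : Torus) : act (A * B) x = act A (act B x) := by
  ext i
  simp only [act_apply, Matrix.SpecialLinearGroup.coe_mul, Matrix.mul_apply, Fin.sum_univ_two,
    smul_add, add_smul, mul_smul]
  abel

theorem continuous_act (A : SL(2, ℤ)) : Continuous (act A) := by
  refine continuous_pi fun i => ?_
  simp only [act_apply]
  fun_prop

theorem measurePreserving_act (A : SL(2, ℤ)) :
    MeasurePreserving (act A) torusMeasure torusMeasure := by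
  refine AddMonoidHom.measurePreserving (continuous_act A) (fun y => ⟨act A⁻¹ y, ?_⟩) rfl
  rw [← act_mul, mul_inv_cancel, act_one]

variable (𝕜 : Type*) [RCLike 𝕜]

/-- The Hilbert space `L²(𝕋², ν)` of `𝕜`-valued functions. -/
abbrev L2 : Type _ := Lp 𝕜 2 torusMeasure

/-- The Koopman operator `f ↦ f ∘ A` on `L²(𝕋², ν)`. -/
def koopman (A : SL(2, ℤ)) : L2 𝕜 →ₗᵢ[𝕜] L2 𝕜 :=
  Lp.compMeasurePreservingₗᵢ 𝕜 (act A) (measurePreserving_act A)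

/-- The limit graphexon operator
`(G f)(x) = (f(T₁ x) + f(T₁⁻¹ x) + f(T₂ x) + f(T₂⁻¹ x)) / 4` on `L²(𝕋², ν)`. -/
def G : L2 𝕜 →L[𝕜] L2 𝕜 :=
  (4 : 𝕜)⁻¹ • ((koopman 𝕜 T₁).toContinuousLinearMap + (koopman 𝕜 T₁⁻¹).toContinuousLinearMap
    + (koopman 𝕜 T₂).toContinuousLinearMap + (koopman 𝕜 T₂⁻¹).toContinuousLinearMap)

/-- `L²₀(𝕋², ν)`: the orthogonal complement of the constant functions in `L²(𝕋², ν)`. -/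
def L20 : Submodule 𝕜 (L2 𝕜) := (𝕜 ∙ (Lp.const 2 torusMeasure (1 : 𝕜) : L2 𝕜))ᗮ

theorem koopman_coeFn (A : SL(2, ℤ)) (f : L2 𝕜) :
    koopman 𝕜 A f =ᵐ[torusMeasure] fun x => f (act A x) :=
  Lp.coeFn_compMeasurePreserving f (measurePreserving_act A)

theorem G_coeFn (f : L2 𝕜) :
    G 𝕜 f =ᵐ[torusMeasure] fun x =>
      (1 / 4 : 𝕜) * (f (act T₁ x) + f (act T₁⁻¹ x) + f (act T₂ x) + f (act T₂⁻¹ x)) := by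
  have e : G 𝕜 f = (4 : 𝕜)⁻¹ •
    (koopman 𝕜 T₁ f + koopman 𝕜 T₁⁻¹ f + koopman 𝕜 T₂ f + koopman 𝕜 T₂⁻¹ f) := rfl
  rw [e]
  filter_upwards [Lp.coeFn_smul (4 : 𝕜)⁻¹
      (koopman 𝕜 T₁ f + koopman 𝕜 T₁⁻¹ f + koopman 𝕜 T₂ f + koopman 𝕜 T₂⁻¹ f),
    Lp.coeFn_add (koopman 𝕜 T₁ f + koopman 𝕜 T₁⁻¹ f + koopman 𝕜 T₂ f) (koopman 𝕜 T₂⁻¹ f),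
    Lp.coeFn_add (koopman 𝕜 T₁ f + koopman 𝕜 T₁⁻¹ f) (koopman 𝕜 T₂ f),
    Lp.coeFn_add (koopman 𝕜 T₁ f) (koopman 𝕜 T₁⁻¹ f),
    koopman_coeFn 𝕜 T₁ f, koopman_coeFn 𝕜 T₁⁻¹ f, koopman_coeFn 𝕜 T₂ f, koopman_coeFn 𝕜 T₂⁻¹ f]
    with x h1 h2 h3 h4 h5 h6 h7 h8
  simp only [h1, Pi.smul_apply, h2, Pi.add_apply, h3, h4, h5, h6, h7, h8, smul_eq_mul, one_div]

theorem koopman_const (A : SL(2, ℤ)) (c : 𝕜) :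
    koopman 𝕜 A (Lp.const 2 torusMeasure c) = Lp.const 2 torusMeasure c := by
  apply Lp.ext
  have hc := Lp.coeFn_const (p := 2) (μ := torusMeasure) c
  filter_upwards [koopman_coeFn 𝕜 A (Lp.const 2 torusMeasure c), hc,
    (measurePreserving_act A).quasiMeasurePreserving.ae_eq_comp hc] with x h1 h2 h3
  rw [h1, h2]
  exact h3

theorem koopman_mem (A : SL(2, ℤ)) {f : L2 𝕜} (hf : f ∈ L20 𝕜) : koopman 𝕜 A f ∈ L20 𝕜 := by
  rw [L20, Submodule.mem_orthogonal_singleton_iff_inner_right] at hf ⊢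
  rw [← koopman_const 𝕜 A 1, LinearIsometry.inner_map_map, hf]

theorem G_mem {f : L2 𝕜} (hf : f ∈ L20 𝕜) : G 𝕜 f ∈ L20 𝕜 :=
  (L20 𝕜).smul_mem _ <| (L20 𝕜).add_mem ((L20 𝕜).add_mem ((L20 𝕜).add_mem
    (koopman_mem 𝕜 T₁ hf) (koopman_mem 𝕜 T₁⁻¹ hf)) (koopman_mem 𝕜 T₂ hf))
    (koopman_mem 𝕜 T₂⁻¹ hf)

/-- The restriction of `G` to the invariant subspace `L²₀(𝕋², ν)`. -/
def G₀ : L20 𝕜 →L[𝕜] L20 𝕜 :=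
  ((G 𝕜).comp (L20 𝕜).subtypeL).codRestrict (L20 𝕜) fun f => G_mem 𝕜 f.2

variable {𝕜}

/-- The continuous spectrum of a bounded operator `T`: the scalars `z` for which `T - z` is
injective with dense range, but not surjective. -/
def continuousSpectrum {E : Type*} [NormedAddCommGroup E] [NormedSpace 𝕜 E] (T : E →L[𝕜] E) :
    Set 𝕜 :=
  {z | Function.Injective (fun f => T f - z • f) ∧ DenseRange (fun f => T f - z • f) ∧
    ¬ Function.Surjective (fun f => T f - z • f)}

end

end TorusExpander

/-! In Fourier coefficients, `G` becomes the average over the four neighbours `step i k` in ℤ², and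
membership in L²₀ means that the coefficient at 0 vanishes. The height x² + y² organises the graph:
a point has at most one inward neighbour, and if it has one, the other three are strictly outward.

Norm bound: a Schur test with weight 1/√3 on outward and √3 on inward edges. The weights at a
nonzero point add up to at most 2√3 (`sum_weight_le`), so the squared norm is at most (2√3)²/16 =
3/4.

No eigenvectors: by symmetry and the norm bound an eigenvalue μ is real with |μ| ≤ √3/2. Off the
axes and diagonals the outward graph is a ternary tree. The sums S_n of an eigenvector over the n-th
descendants satisfy S_{n+2} = 4μ S_{n+1} - 3 S_n, so b_n = S_n/√3^n solves b_{n+2} = 2c b_{n+1} -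
b_n with c = 2μ/√3, |c| ≤ 1, which has no nonzero solution tending to 0. But |b_n|² is at most the
ℓ² mass on generation n, which tends to 0. The remaining nonzero points are parents of generic ones,
so the eigenvector vanishes there too.

The spectral claims are then general facts about symmetric bounded operators without eigenvectors.
Real scalars are reduced to complex ones by `complexify`. -/

namespace TorusExpander

/-! ### Lattice graph and its height function -/

/-- The four neighbours of a lattice point: its images under `T₁`, `T₁⁻¹`, `T₂`, `T₂⁻¹`. -/
def step : Fin 4 → ℤ × ℤ → ℤ × ℤ
  | 0, k => (k.1 + 2 * k.2, k.2)
  | 1, k => (k.1 - 2 * k.2, k.2)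
  | 2, k => (k.1, k.2 + 2 * k.1)
  | 3, k => (k.1, k.2 - 2 * k.1)

/-- A quarter of the increment of `x ^ 2 + y ^ 2` along a step. -/
def incr : Fin 4 → ℤ × ℤ → ℤ
  | 0, k => k.2 * (k.1 + k.2)
  | 1, k => k.2 * (k.2 - k.1)
  | 2, k => k.1 * (k.1 + k.2)
  | 3, k => k.1 * (k.1 - k.2)

/-- The index of the inverse step. -/
def opp : Fin 4 → Fin 4
  | 0 => 1
  | 1 => 0
  | 2 => 3
  | 3 => 2

theorem opp_opp (i : Fin 4) : opp (opp i) = i := by fin_cases i <;> rfl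

theorem step_opp_step (i : Fin 4) (k : ℤ × ℤ) : step (opp i) (step i k) = k := by
  fin_cases i <;> simp [step, opp]

theorem incr_opp_step (i : Fin 4) (k : ℤ × ℤ) : incr (opp i) (step i k) = -incr i k := by
  fin_cases i <;> simp only [step, opp, incr] <;> ring

theorem step_zero (i : Fin 4) : step i 0 = 0 := by fin_cases i <;> simp [step]

/-- A step as a permutation of the lattice. -/
def stepEquiv (i : Fin 4) : ℤ × ℤ ≃ ℤ × ℤ where
  toFun := step i
  invFun := step (opp i)
  left_inv := step_opp_step i
  right_inv k := by simpa only [opp_opp] using step_opp_step (opp i) k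

/-- A negative increment, say y(x + y) < 0, forces xy < 0 and |x| > |y| > 0, and these make the
other three increments positive. The other cases are symmetric. -/
theorem incr_pos_of_neg {k : ℤ × ℤ} {i j : Fin 4} (hi : incr i k < 0) (hij : j ≠ i) :
    0 < incr j k := by
  obtain ⟨x, y⟩ := k
  have hx : x ≠ 0 ∨ 0 ≤ incr i (x, y) := by
    by_contra! h
    obtain ⟨rfl, h⟩ := h
    revert h; fin_cases i <;> simp [incr] <;> nlinarith [mul_self_nonneg y]
  have hy : y ≠ 0 ∨ 0 ≤ incr i (x, y) := by
    by_contra! h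
    obtain ⟨rfl, h⟩ := h
    revert h; fin_cases i <;> simp [incr] <;> nlinarith [mul_self_nonneg x]
  have hx' : 0 < x ^ 2 := by have := hx.resolve_right (not_le.2 hi); positivity
  have hy' : 0 < y ^ 2 := by have := hy.resolve_right (not_le.2 hi); positivity
  clear hx hy
  fin_cases i <;> fin_cases j <;> first | exact absurd rfl hij | skip
  all_goals
    simp only [incr] at hi ⊢
    nlinarith [sq_nonneg (x + y), sq_nonneg (x - y)]

/-! ### Weighted Schur test -/

/-- The weight of an edge of the lattice graph: `1 / √3` outwards, `√3` inwards. -/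
noncomputable def weight (t : ℤ) : ℝ := if 0 < t then (√3)⁻¹ else if t = 0 then 1 else √3

theorem weight_pos (t : ℤ) : 0 < weight t := by
  unfold weight; split_ifs <;> positivity

theorem weight_neg (t : ℤ) : weight (-t) = (weight t)⁻¹ := by
  unfold weight
  rcases lt_trichotomy t 0 with h | h | h
  · simp [h, h.not_gt, h.ne]
  · simp [h]
  · simp [h, h.not_gt, h.ne']

theorem one_le_sqrt_three : (1 : ℝ) ≤ √3 := by
  rw [Real.le_sqrt] <;> norm_num

theorem weight_of_pos {t : ℤ} (h : 0 < t) : weight t = (√3)⁻¹ := if_pos h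

theorem weight_le_one {t : ℤ} (h : 0 ≤ t) : weight t ≤ 1 := by
  unfold weight
  split_ifs with h1 h2
  · exact inv_le_one_of_one_le₀ one_le_sqrt_three
  · exact le_rfl
  · omega

theorem weight_of_neg {t : ℤ} (h : t < 0) : weight t = √3 := by
  simp [weight, h.not_gt, h.ne]

theorem inv_sqrt_three : (√3 : ℝ)⁻¹ = √3 / 3 := by
  have h : (√3 : ℝ) * √3 = 3 := Real.mul_self_sqrt (by norm_num)
  field_simp
  linarith

/-- With an inward neighbour the sum is exactly √3 + 3/√3 = 2√3. Without one, at least two edges are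
strictly outward and the other weights are at most 1, giving 2 + 2/√3 < 2√3. -/
theorem sum_weight_le {k : ℤ × ℤ} (hk : k ≠ 0) : ∑ i, weight (incr i k) ≤ 2 * √3 := by
  have h17 : (1.7 : ℝ) ≤ √3 := by rw [Real.le_sqrt] <;> norm_num
  by_cases hneg : ∃ i, incr i k < 0
  · obtain ⟨i, hi⟩ := hneg
    rw [← Finset.add_sum_erase _ _ (Finset.mem_univ i), weight_of_neg hi,
      Finset.sum_congr rfl fun j hj => weight_of_pos (incr_pos_of_neg hi (Finset.ne_of_mem_erase hj)),
      Finset.sum_const, Finset.card_erase_of_mem (Finset.mem_univ i), inv_sqrt_three]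
    simp
    linarith
  · push Not at hneg
    -- Applied to the opposite pairs 0, 1 and 2, 3, whose increments add up to 2y² and 2x².
    have key : ∀ i j : Fin 4, 0 < incr i k + incr j k →
        weight (incr i k) + weight (incr j k) ≤ 1 + √3 / 3 := by
      intro i j hij
      rcases (hneg i).lt_or_eq with h | h
      · rw [weight_of_pos h, inv_sqrt_three]
        linarith [weight_le_one (hneg j)]
      · have h' : 0 < incr j k := by omega
        rw [weight_of_pos h', inv_sqrt_three]
        linarith [weight_le_one (hneg i)]
    rw [Fin.sum_univ_four]
    obtain ⟨x, y⟩ := k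
    by_cases hx : x = 0
    · subst hx
      have hy : y ≠ 0 := by rintro rfl; exact hk rfl
      have h0 : 0 < y * y := mul_self_pos.2 hy
      have e0 : 0 < incr 0 (0, y) := by simpa [incr] using h0
      have e1 : 0 < incr 1 (0, y) := by simpa [incr] using h0
      rw [weight_of_pos e0, weight_of_pos e1, inv_sqrt_three]
      linarith [weight_le_one (hneg 2), weight_le_one (hneg 3)]
    · have hx2 : 0 < x ^ 2 := by positivity
      have h23 := key 2 3 (by simp only [incr]; nlinarith)
      by_cases hy : y = 0
      · subst hy
        have e0 : 0 < incr 2 (x, 0) := by simp only [incr]; nlinarith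
        have e1 : 0 < incr 3 (x, 0) := by simp only [incr]; nlinarith
        rw [weight_of_pos e0, weight_of_pos e1, inv_sqrt_three]
        linarith [weight_le_one (hneg 0), weight_le_one (hneg 1)]
      · have hy2 : 0 < y ^ 2 := by positivity
        have h01 := key 0 1 (by simp only [incr]; nlinarith)
        linarith

/-- The averaging operator over the four neighbours. -/
noncomputable def avg (a : ℤ × ℤ → ℂ) (k : ℤ × ℤ) : ℂ := (1 / 4 : ℂ) * ∑ i, a (step i k)

/-- Cauchy–Schwarz, splitting each term by the edge weight: the weight of the reversed edge is the
inverse. The constant is 2√3/16. -/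
theorem norm_avg_sq_le {a : ℤ × ℤ → ℂ} (h0 : a 0 = 0) (k : ℤ × ℤ) :
    ‖avg a k‖ ^ 2 ≤ √3 / 8 * ∑ i, weight (incr (opp i) (step i k)) * ‖a (step i k)‖ ^ 2 := by
  have hnn : 0 ≤ ∑ i, weight (incr (opp i) (step i k)) * ‖a (step i k)‖ ^ 2 :=
    Finset.sum_nonneg fun i _ => mul_nonneg (weight_pos _).le (by positivity)
  by_cases hk : k = 0
  · subst hk
    simp [avg, step_zero, h0]
  have h1 : ‖avg a k‖ ≤ 1 / 4 * ∑ i, ‖a (step i k)‖ := by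
    rw [avg, norm_mul]
    gcongr
    · norm_num
    · exact norm_sum_le _ _
  have h2 : (∑ i, ‖a (step i k)‖) ^ 2 ≤ (∑ i, weight (incr i k)) *
      ∑ i, weight (incr (opp i) (step i k)) * ‖a (step i k)‖ ^ 2 := by
    refine Finset.sum_sq_le_sum_mul_sum_of_sq_le_mul _ (fun i _ => (weight_pos _).le)
      (fun i _ => mul_nonneg (weight_pos _).le (by positivity)) fun i _ => ?_
    rw [incr_opp_step, weight_neg, ← mul_assoc, mul_inv_cancel₀ (weight_pos _).ne', one_mul]
  calc ‖avg a k‖ ^ 2 ≤ (1 / 4 * ∑ i, ‖a (step i k)‖) ^ 2 := by gcongr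
    _ = 1 / 16 * (∑ i, ‖a (step i k)‖) ^ 2 := by ring
    _ ≤ 1 / 16 * (2 * √3 * ∑ i, weight (incr (opp i) (step i k)) * ‖a (step i k)‖ ^ 2) := by
        gcongr
        exact h2.trans (mul_le_mul_of_nonneg_right (sum_weight_le hk) hnn)
    _ = _ := by ring

theorem weight_le (t : ℤ) : weight t ≤ √3 := by
  rcases lt_or_ge t 0 with h | h
  · exact (weight_of_neg h).le
  · exact (weight_le_one h).trans one_le_sqrt_three

theorem summable_weight_mul {h : ℤ × ℤ → ℝ} (hh : Summable h) (h0 : ∀ k, 0 ≤ h k) (i : Fin 4) :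
    Summable fun k => weight (incr i k) * h k :=
  (hh.mul_left √3).of_nonneg_of_le (fun k => mul_nonneg (weight_pos _).le (h0 k))
    (fun k => mul_le_mul_of_nonneg_right (weight_le _) (h0 k))

/-- Double counting of edges: each step permutes the lattice, and `opp` permutes the four steps. -/
theorem hasSum_weight_mul_step {h : ℤ × ℤ → ℝ} (hh : Summable h) (h0 : ∀ k, 0 ≤ h k) :
    HasSum (fun k => ∑ i, weight (incr (opp i) (step i k)) * h (step i k))
      (∑' k, (∑ i, weight (incr i k)) * h k) := by
  have e : ∑' k, (∑ i, weight (incr i k)) * h k = ∑ i, ∑' k, weight (incr (opp i) k) * h k := by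
    simp only [Finset.sum_mul]
    rw [Summable.tsum_finsetSum fun i _ => summable_weight_mul hh h0 i]
    simp only [Fin.sum_univ_four, opp]
    ring
  rw [e]
  exact hasSum_sum fun i _ =>
    (stepEquiv i).hasSum_iff.2 (summable_weight_mul hh h0 (opp i)).hasSum

theorem tsum_norm_avg_sq_le {a : ℤ × ℤ → ℂ} (h0 : a 0 = 0) (ha : Summable fun k => ‖a k‖ ^ 2) :
    ∑' k, ‖avg a k‖ ^ 2 ≤ 3 / 4 * ∑' k, ‖a k‖ ^ 2 := by
  have hnn : ∀ k, 0 ≤ ‖a k‖ ^ 2 := fun k => sq_nonneg _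
  have hsum := (hasSum_weight_mul_step ha hnn).mul_left (√3 / 8)
  have h33 : (√3 : ℝ) * √3 = 3 := Real.mul_self_sqrt (by norm_num)
  have hle : ∑' k, (∑ i, weight (incr i k)) * ‖a k‖ ^ 2 ≤ 2 * √3 * ∑' k, ‖a k‖ ^ 2 := by
    rw [← tsum_mul_left]
    refine Summable.tsum_le_tsum (fun k => ?_) ?_ (ha.mul_left _)
    · by_cases hk : k = 0
      · simp [hk, h0]
      · exact mul_le_mul_of_nonneg_right (sum_weight_le hk) (hnn k)
    · simp only [Finset.sum_mul]
      exact summable_sum fun i _ => summable_weight_mul ha hnn i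
  calc ∑' k, ‖avg a k‖ ^ 2
      ≤ √3 / 8 * ∑' k, (∑ i, weight (incr i k)) * ‖a k‖ ^ 2 := by
        rw [← hsum.tsum_eq]
        exact (hsum.summable.of_nonneg_of_le (fun _ => sq_nonneg _)
          (norm_avg_sq_le h0)).tsum_le_tsum (norm_avg_sq_le h0) hsum.summable
    _ ≤ √3 / 8 * (2 * √3 * ∑' k, ‖a k‖ ^ 2) := mul_le_mul_of_nonneg_left hle (by positivity)
    _ = 3 / 4 * ∑' k, ‖a k‖ ^ 2 := by
        linear_combination (1 / 4 * ∑' k, ‖a k‖ ^ 2) * h33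

/-! ### Square-summable eigenvectors on the tree -/

/-- A solution of `b (n + 2) = 2 c b (n + 1) - b n`, `|c| ≤ 1`, which tends to zero vanishes. -/
theorem eq_zero_of_recurrence {b : ℕ → ℂ} {c : ℝ} (hc : |c| ≤ 1)
    (hrec : ∀ n, b (n + 2) = 2 * c * b (n + 1) - b n)
    (hb : Filter.Tendsto b Filter.atTop (nhds 0)) : b 0 = 0 := by
  have hc2 : 0 ≤ 1 - c ^ 2 := by
    have := (sq_le_one_iff_abs_le_one c).2 hc
    linarith
  -- The conserved quadratic form |b_{n+1}|² - 2c Re(b_{n+1} b̄_n) + |b_n|², with the square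
  -- completed; |c| ≤ 1 makes it nonnegative.
  set Q : ℕ → ℝ := fun n => ‖b (n + 1) - c * b n‖ ^ 2 + (1 - c ^ 2) * ‖b n‖ ^ 2 with hQ
  have hstep : ∀ n, Q (n + 1) = Q n := by
    intro n
    simp only [hQ, hrec n, Complex.sq_norm, Complex.normSq_apply, Complex.sub_re, Complex.sub_im,
      Complex.mul_re, Complex.mul_im, Complex.ofReal_re, Complex.ofReal_im, Complex.re_ofNat,
      Complex.im_ofNat]
    ring
  have hconst : ∀ n, Q n = Q 0 := fun n => by
    induction n with
    | zero => rfl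
    | succ n ih => rw [hstep, ih]
  have hlim : Filter.Tendsto Q Filter.atTop (nhds 0) := by
    have hb1 := hb.comp (Filter.tendsto_add_atTop_nat 1)
    have := (((hb1.sub (hb.const_mul (c : ℂ))).norm.pow 2).add
      ((hb.norm.pow 2).const_mul (1 - c ^ 2)))
    simpa [Function.comp_def] using this
  have hQ0 : ∀ n, Q n = 0 := fun n => by
    rw [hconst n, tendsto_nhds_unique tendsto_const_nhds (hlim.congr hconst)]
  have h1 : ∀ n, ‖b (n + 1) - c * b n‖ ^ 2 = 0 ∧ (1 - c ^ 2) * ‖b n‖ ^ 2 = 0 := fun n =>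
    (add_eq_zero_iff_of_nonneg (by positivity) (by positivity)).1 (hQ0 n)
  rcases mul_eq_zero.1 (h1 0).2 with h | h
  -- In the degenerate case, `Q = 0` only gives b_{n+1} = c b_n; then |b_n| is constant and has
  -- limit 0.
  · have hca : |c| = 1 := by
      rw [← pow_eq_one_iff_of_nonneg (abs_nonneg c) two_ne_zero, sq_abs]
      linarith
    have hn : ∀ n, ‖b n‖ = ‖b 0‖ := fun n => by
      induction n with
      | zero => rfl
      | succ n ih =>
        have := (h1 n).1
        rw [sq_eq_zero_iff, norm_eq_zero, sub_eq_zero] at this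
        rw [this, norm_mul, Complex.norm_real, Real.norm_eq_abs, hca, one_mul, ih]
    have h2 := hb.norm
    simp only [hn, norm_zero] at h2
    exact norm_eq_zero.1 (tendsto_nhds_unique tendsto_const_nhds h2)
  · simpa using h

/-- The lattice points off the axes and the diagonals, at which the lattice graph is a tree. -/
def IsGeneric (k : ℤ × ℤ) : Prop := k.1 ≠ 0 ∧ k.2 ≠ 0 ∧ k.1 + k.2 ≠ 0 ∧ k.1 - k.2 ≠ 0

/-- The sum over the outward neighbours. -/
noncomputable def outSum {M : Type*} [AddCommMonoid M] (g : ℤ × ℤ → M) (k : ℤ × ℤ) : M :=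
  ∑ i, if 0 < incr i k then g (step i k) else 0

/-- The inward neighbour, if there is one. -/
def parent (k : ℤ × ℤ) : ℤ × ℤ :=
  if incr 0 k < 0 then step 0 k else if incr 1 k < 0 then step 1 k else
    if incr 2 k < 0 then step 2 k else if incr 3 k < 0 then step 3 k else k

theorem parent_of_incr_neg {k : ℤ × ℤ} {i : Fin 4} (hi : incr i k < 0) : parent k = step i k := by
  have h : ∀ j, j ≠ i → ¬ incr j k < 0 := fun j hj => (incr_pos_of_neg hi hj).not_gt
  match i, hi, h with
  | 0, hi, _ => exact if_pos hi
  | 1, hi, h => rw [parent, if_neg (h 0 (by decide)), if_pos hi]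
  | 2, hi, h => rw [parent, if_neg (h 0 (by decide)), if_neg (h 1 (by decide)), if_pos hi]
  | 3, hi, h =>
    rw [parent, if_neg (h 0 (by decide)), if_neg (h 1 (by decide)), if_neg (h 2 (by decide)),
      if_pos hi]

theorem IsGeneric.exists_incr_neg {k : ℤ × ℤ} (hk : IsGeneric k) : ∃ i, incr i k < 0 := by
  obtain ⟨x, y⟩ := k
  obtain ⟨hx, hy, hs, hd⟩ := hk
  simp only at hx hy hs hd
  by_contra! h
  have h0 := h 0
  have h1 := h 1
  have h2 := h 2
  have h3 := h 3
  simp only [incr] at h0 h1 h2 h3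
  rcases lt_or_gt_of_ne hx with hx | hx <;> rcases lt_or_gt_of_ne hy with hy | hy <;>
  rcases lt_or_gt_of_ne hs with hs | hs <;> rcases lt_or_gt_of_ne hd with hd | hd <;>
  nlinarith

theorem parent_step {k : ℤ × ℤ} {i : Fin 4} (hi : 0 < incr i k) : parent (step i k) = k := by
  rw [parent_of_incr_neg (i := opp i) (by rw [incr_opp_step]; omega), step_opp_step]

/-- Landing on an axis or diagonal would need x = ±y, ±2y, ±3y or y = ±2x, ±3x; the first is
excluded by genericity, the others with the sign that makes the step inward. -/
theorem IsGeneric.step {k : ℤ × ℤ} (hk : IsGeneric k) {i : Fin 4} (hi : 0 < incr i k) :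
    IsGeneric (step i k) := by
  obtain ⟨x, y⟩ := k
  obtain ⟨hx, hy, hs, hd⟩ := hk
  simp only at hx hy hs hd
  fin_cases i <;> simp only [incr] at hi <;>
    simp only [IsGeneric, TorusExpander.step] <;> refine ⟨?_, ?_, ?_, ?_⟩ <;>
    first
    | assumption
    | (intro h; apply hs; linarith)
    | (intro h; apply hd; linarith)
    | (intro h
       first
       | (have e : x = -2 * y := by linarith
          subst e; nlinarith [mul_self_nonneg y])
       | (have e : x = 2 * y := by linarith
          subst e; nlinarith [mul_self_nonneg y])
       | (have e : y = -2 * x := by linarith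
          subst e; nlinarith [mul_self_nonneg x])
       | (have e : y = 2 * x := by linarith
          subst e; nlinarith [mul_self_nonneg x])
       | (have e : x = -3 * y := by linarith
          subst e; nlinarith [mul_self_nonneg y])
       | (have e : x = 3 * y := by linarith
          subst e; nlinarith [mul_self_nonneg y])
       | (have e : y = -3 * x := by linarith
          subst e; nlinarith [mul_self_nonneg x])
       | (have e : y = 3 * x := by linarith
          subst e; nlinarith [mul_self_nonneg x]))

theorem IsGeneric.step_injective {k : ℤ × ℤ} (hk : IsGeneric k) :
    Function.Injective fun i => TorusExpander.step i k := by
  obtain ⟨x, y⟩ := k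
  obtain ⟨hx, hy, -, -⟩ := hk
  simp only at hx hy
  intro i j h
  fin_cases i <;> fin_cases j <;> simp [TorusExpander.step] at h ⊢ <;> omega

/-- The squared Euclidean norm of a lattice point. -/
def sqNorm (k : ℤ × ℤ) : ℤ := k.1 ^ 2 + k.2 ^ 2

theorem sqNorm_step (i : Fin 4) (k : ℤ × ℤ) : sqNorm (step i k) = sqNorm k + 4 * incr i k := by
  fin_cases i <;> simp only [sqNorm, step, incr] <;> ring

theorem sqNorm_parent_le (k : ℤ × ℤ) : sqNorm (parent k) ≤ sqNorm k := by
  by_cases h : ∃ i, incr i k < 0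
  · obtain ⟨i, hi⟩ := h
    rw [parent_of_incr_neg hi, sqNorm_step]
    omega
  -- With no inward neighbour `parent` is the identity.
  · push Not at h
    simp [parent, (h _).not_gt]

theorem IsGeneric.sqNorm_parent_lt {k : ℤ × ℤ} (hk : IsGeneric k) :
    sqNorm (parent k) < sqNorm k := by
  obtain ⟨i, hi⟩ := hk.exists_incr_neg
  rw [parent_of_incr_neg hi, sqNorm_step]
  omega

theorem sqNorm_iterate_parent_le (n : ℕ) (k : ℤ × ℤ) : sqNorm (parent^[n] k) ≤ sqNorm k := by
  induction n with
  | zero => rfl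
  | succ n ih =>
    rw [Function.iterate_succ_apply']
    exact (sqNorm_parent_le _).trans ih

/-- An ancestor chain meets `k` at most once: it drops strictly in height on leaving `k` and never
rises again. -/
theorem IsGeneric.eventually_iterate_parent_ne {k : ℤ × ℤ} (hk : IsGeneric k) (v : ℤ × ℤ) :
    ∀ᶠ n in Filter.atTop, parent^[n] v ≠ k := by
  by_cases h : ∃ m, parent^[m] v = k
  · obtain ⟨m, hm⟩ := h
    filter_upwards [Filter.eventually_gt_atTop m] with n hn he
    obtain ⟨d, rfl⟩ := Nat.exists_eq_add_of_lt hn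
    rw [show m + d + 1 = d + 1 + m by omega, Function.iterate_add_apply, hm,
      Function.iterate_succ_apply] at he
    have h1 := sqNorm_iterate_parent_le d (parent k)
    rw [he] at h1
    exact h1.not_gt hk.sqNorm_parent_lt
  · push Not at h
    exact Filter.Eventually.of_forall h

theorem IsGeneric.sum_ite_step_le {k : ℤ × ℤ} (hk : IsGeneric k) (w : ℤ × ℤ) {c : ℝ}
    (hc : 0 ≤ c) :
    (∑ i, if 0 < incr i k then (if w = TorusExpander.step i k then c else 0) else 0) ≤
      if parent w = k then c else 0 := by
  by_cases h : ∃ i, 0 < incr i k ∧ w = TorusExpander.step i k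
  · obtain ⟨i, hi, rfl⟩ := h
    rw [if_pos (parent_step hi), Finset.sum_eq_single i]
    · simp [hi]
    · intro j _ hj
      rw [if_neg fun e => hj (hk.step_injective e).symm, ite_self]
    · simp
  · push Not at h
    rw [Finset.sum_eq_zero]
    · split_ifs <;> simp [hc]
    · intro i _
      split_ifs with h1 h2
      · exact absurd h2 (h i h1)
      · rfl
      · rfl

/-- The n-th descendants of `k` are distinct points whose n-th ancestor is `k`. -/
theorem IsGeneric.iterate_outSum_le {h : ℤ × ℤ → ℝ} (hh : Summable h) (h0 : ∀ k, 0 ≤ h k)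
    (n : ℕ) {k : ℤ × ℤ} (hk : IsGeneric k) :
    outSum^[n] h k ≤ ∑' v, if parent^[n] v = k then h v else 0 := by
  have hs : ∀ p : ℤ × ℤ → Prop, ∀ [DecidablePred p], Summable fun v => if p v then h v else 0 :=
    fun p _ => hh.of_nonneg_of_le (fun v => by split_ifs <;> simp [h0])
      (fun v => by split_ifs <;> simp [h0])
  induction n generalizing k with
  | zero => exact (tsum_ite_eq k h).ge
  | succ n ih =>
    have hs1 : ∀ i, Summable fun v => if 0 < incr i k then
        (if parent^[n] v = TorusExpander.step i k then h v else 0) else 0 := fun i => by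
      split_ifs
      · exact hs _
      · exact summable_zero
    rw [Function.iterate_succ_apply']
    calc outSum (outSum^[n] h) k
        ≤ ∑ i, ∑' v, if 0 < incr i k then
            (if parent^[n] v = TorusExpander.step i k then h v else 0) else 0 := by
          refine Finset.sum_le_sum fun i _ => ?_
          split_ifs with hi
          · exact ih (hk.step hi)
          · simp
      _ = ∑' v, ∑ i, if 0 < incr i k then
            (if parent^[n] v = TorusExpander.step i k then h v else 0) else 0 :=
          (Summable.tsum_finsetSum fun i _ => hs1 i).symm
      _ ≤ ∑' v, if parent^[n + 1] v = k then h v else 0 := by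
          refine Summable.tsum_le_tsum (fun v => ?_) (summable_sum fun i _ => hs1 i) (hs _)
          rw [Function.iterate_succ_apply']
          exact hk.sum_ite_step_le _ (h0 v)

theorem iterate_outSum_nonneg {h : ℤ × ℤ → ℝ} (h0 : ∀ k, 0 ≤ h k) (n : ℕ) (k : ℤ × ℤ) :
    0 ≤ outSum^[n] h k := by
  induction n generalizing k with
  | zero => exact h0 k
  | succ n ih =>
    rw [Function.iterate_succ_apply']
    refine Finset.sum_nonneg fun i _ => ?_
    split_ifs
    · exact ih _
    · exact le_rfl

/-- Dominated convergence: each lattice point eventually stops contributing. -/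
theorem IsGeneric.tendsto_iterate_outSum {h : ℤ × ℤ → ℝ} (hh : Summable h) (h0 : ∀ k, 0 ≤ h k)
    {k : ℤ × ℤ} (hk : IsGeneric k) :
    Filter.Tendsto (fun n => outSum^[n] h k) Filter.atTop (nhds 0) := by
  have hlim : Filter.Tendsto (fun n : ℕ => ∑' v, if parent^[n] v = k then h v else 0)
      Filter.atTop (nhds (∑' _ : ℤ × ℤ, (0 : ℝ))) := by
    refine tendsto_tsum_of_dominated_convergence hh (fun v => ?_)
      (Filter.Eventually.of_forall fun n v => ?_)
    · refine tendsto_const_nhds.congr' ?_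
      filter_upwards [hk.eventually_iterate_parent_ne v] with n hn
      rw [if_neg hn]
    · split_ifs
      · rw [Real.norm_of_nonneg (h0 v)]
      · rw [norm_zero]; exact h0 v
  rw [tsum_zero] at hlim
  exact squeeze_zero (fun n => iterate_outSum_nonneg h0 n k)
    (fun n => hk.iterate_outSum_le hh h0 n) hlim

theorem outSum_eq_sum_erase {M : Type*} [AddCommMonoid M] {k : ℤ × ℤ} {i : Fin 4}
    (hi : incr i k < 0) (g : ℤ × ℤ → M) :
    outSum g k = ∑ j ∈ Finset.univ.erase i, g (step j k) := by
  rw [outSum, ← Finset.add_sum_erase _ _ (Finset.mem_univ i), if_neg hi.not_gt, zero_add]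
  exact Finset.sum_congr rfl fun j hj => if_pos (incr_pos_of_neg hi (Finset.ne_of_mem_erase hj))

theorem IsGeneric.sum_step {k : ℤ × ℤ} (hk : IsGeneric k) (g : ℤ × ℤ → ℂ) :
    ∑ i, g (TorusExpander.step i k) = g (parent k) + outSum g k := by
  obtain ⟨i, hi⟩ := hk.exists_incr_neg
  rw [outSum_eq_sum_erase hi, parent_of_incr_neg hi,
    Finset.add_sum_erase _ (fun j => g (TorusExpander.step j k)) (Finset.mem_univ i)]

theorem outSum_congr {M : Type*} [AddCommMonoid M] {g h : ℤ × ℤ → M}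
    (H : ∀ k, IsGeneric k → g k = h k) {k : ℤ × ℤ} (hk : IsGeneric k) :
    outSum g k = outSum h k := by
  refine Finset.sum_congr rfl fun i _ => ?_
  split_ifs with hi
  · exact H _ (hk.step hi)
  · rfl

theorem IsGeneric.outSum_comp_parent {k : ℤ × ℤ} (hk : IsGeneric k) (g : ℤ × ℤ → ℂ) :
    outSum (fun v => g (parent v)) k = 3 * g k := by
  have h1 : outSum (fun v => g (parent v)) k = outSum (fun _ => g k) k := by
    refine Finset.sum_congr rfl fun i _ => ?_
    split_ifs with hi
    · simp only [parent_step hi]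
    · rfl
  obtain ⟨i, hi⟩ := hk.exists_incr_neg
  rw [h1, outSum_eq_sum_erase hi, Finset.sum_const, Finset.card_erase_of_mem (Finset.mem_univ i)]
  simp

theorem IsGeneric.sq_norm_outSum_le {k : ℤ × ℤ} (hk : IsGeneric k) (g : ℤ × ℤ → ℂ) :
    ‖outSum g k‖ ^ 2 ≤ 3 * outSum (fun v => ‖g v‖ ^ 2) k := by
  obtain ⟨i, hi⟩ := hk.exists_incr_neg
  rw [outSum_eq_sum_erase hi, outSum_eq_sum_erase hi]
  calc ‖∑ j ∈ Finset.univ.erase i, g (TorusExpander.step j k)‖ ^ 2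
      ≤ (∑ j ∈ Finset.univ.erase i, ‖g (TorusExpander.step j k)‖) ^ 2 := by
        gcongr
        exact norm_sum_le _ _
    _ ≤ _ := sq_sum_le_card_mul_sum_sq
    _ = _ := by
        rw [Finset.card_erase_of_mem (Finset.mem_univ i)]
        simp

theorem outSum_smul_add (c d : ℂ) (g h : ℤ × ℤ → ℂ) (k : ℤ × ℤ) :
    outSum (fun v => c * g v + d * h v) k = c * outSum g k + d * outSum h k := by
  simp only [outSum, Finset.mul_sum, ← Finset.sum_add_distrib]
  refine Finset.sum_congr rfl fun i _ => ?_
  split_ifs <;> simp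

theorem outSum_mono {g h : ℤ × ℤ → ℝ} (H : ∀ k, IsGeneric k → g k ≤ h k) {k : ℤ × ℤ}
    (hk : IsGeneric k) : outSum g k ≤ outSum h k := by
  refine Finset.sum_le_sum fun i _ => ?_
  split_ifs with hi
  · exact H _ (hk.step hi)
  · rfl

theorem outSum_const_mul (c : ℝ) (g : ℤ × ℤ → ℝ) (k : ℤ × ℤ) :
    outSum (fun v => c * g v) k = c * outSum g k := by
  simp only [outSum, Finset.mul_sum]
  refine Finset.sum_congr rfl fun i _ => ?_
  split_ifs <;> simp

theorem IsGeneric.sq_norm_iterate_outSum_le (g : ℤ × ℤ → ℂ) (n : ℕ) {k : ℤ × ℤ}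
    (hk : IsGeneric k) :
    ‖outSum^[n] g k‖ ^ 2 ≤ 3 ^ n * outSum^[n] (fun v => ‖g v‖ ^ 2) k := by
  induction n generalizing k with
  | zero => simp
  | succ n ih =>
    rw [Function.iterate_succ_apply', Function.iterate_succ_apply']
    refine (hk.sq_norm_outSum_le _).trans ?_
    rw [pow_succ', mul_assoc, ← outSum_const_mul (3 ^ n)]
    exact mul_le_mul_of_nonneg_left (outSum_mono (fun v hv => ih hv) hk) zero_le_three

/-- The eigenvalue equation reads `outSum a = 4μ a - a ∘ parent` at generic points; applying
`outSum` turns `a ∘ parent` into `3 a`, one copy per child. -/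
theorem IsGeneric.iterate_outSum_recurrence {a : ℤ × ℤ → ℂ} {μ : ℂ}
    (hev : ∀ k, avg a k = μ * a k) (n : ℕ) {k : ℤ × ℤ} (hk : IsGeneric k) :
    outSum^[n + 2] a k = 4 * μ * outSum^[n + 1] a k - 3 * outSum^[n] a k := by
  induction n generalizing k with
  | zero =>
    have h1 : ∀ v, IsGeneric v → outSum a v = 4 * μ * a v + (-1) * a (parent v) := fun v hv => by
      have h2 := hev v
      rw [avg, hv.sum_step] at h2
      linear_combination 4 * h2
    simp only [zero_add, Function.iterate_succ_apply', Function.iterate_zero, id]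
    rw [outSum_congr h1 hk, outSum_smul_add, hk.outSum_comp_parent]
    ring
  | succ n ih =>
    rw [show n + 1 + 2 = (n + 2) + 1 by ring, Function.iterate_succ_apply']
    have h1 : ∀ v, IsGeneric v →
        outSum^[n + 2] a v = 4 * μ * outSum^[n + 1] a v + (-3) * outSum^[n] a v :=
      fun v hv => by rw [ih hv]; ring
    rw [outSum_congr h1 hk, outSum_smul_add, ← Function.iterate_succ_apply' outSum (n + 1) a,
      ← Function.iterate_succ_apply' outSum n a]
    ring

theorem IsGeneric.eq_zero {a : ℤ × ℤ → ℂ} {μ : ℝ} (hμ : |μ| ≤ √3 / 2)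
    (hev : ∀ k, avg a k = μ * a k) (ha : Summable fun k => ‖a k‖ ^ 2) {k : ℤ × ℤ}
    (hk : IsGeneric k) : a k = 0 := by
  have h3 : (0 : ℝ) < √3 := by positivity
  have h33 : (√3 : ℝ) * √3 = 3 := Real.mul_self_sqrt (by norm_num)
  have h33' : ((√3 : ℝ) : ℂ) * (√3 : ℝ) = 3 := by exact_mod_cast h33
  have h3' : ((√3 : ℝ) : ℂ) ≠ 0 := by exact_mod_cast h3.ne'
  set b : ℕ → ℂ := fun n => outSum^[n] a k / ((√3 : ℝ) : ℂ) ^ n with hb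
  have hb0 : b 0 = 0 := by
    refine eq_zero_of_recurrence (c := 2 * μ / √3) ?_ (fun n => ?_) ?_
    · rw [abs_div, abs_mul, abs_of_pos h3, div_le_one h3, abs_of_pos two_pos]
      linarith
    · simp only [hb]
      rw [hk.iterate_outSum_recurrence hev]
      push_cast
      rw [pow_add, pow_add, sq, pow_one]
      field_simp
      rw [show ((√3 : ℝ) : ℂ) ^ 2 = 3 by rw [sq, h33']]
      ring
    · have h1 := hk.tendsto_iterate_outSum ha fun _ => sq_nonneg _
      rw [tendsto_zero_iff_norm_tendsto_zero]
      have h2 : ∀ n, ‖b n‖ ^ 2 ≤ outSum^[n] (fun v => ‖a v‖ ^ 2) k := fun n => by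
        have := hk.sq_norm_iterate_outSum_le a n
        simp only [hb]
        rw [norm_div, norm_pow, Complex.norm_real, Real.norm_of_nonneg h3.le, div_pow, ← pow_mul,
          mul_comm n, pow_mul, sq (√3), h33]
        rw [div_le_iff₀ (by positivity)]
        linarith
      have h4 := (squeeze_zero (fun n => sq_nonneg _) h2 h1).sqrt
      simpa using h4
  simpa [hb] using hb0

theorem eq_zero_of_avg_eq {a : ℤ × ℤ → ℂ} {μ : ℝ} (hμ : |μ| ≤ √3 / 2)
    (hev : ∀ k, avg a k = μ * a k) (ha : Summable fun k => ‖a k‖ ^ 2) (h0 : a 0 = 0) :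
    a = 0 := by
  have hg : ∀ {k}, IsGeneric k → a k = 0 := fun hk => hk.eq_zero hμ hev ha
  have hp : ∀ {k}, IsGeneric k → a (parent k) = 0 := fun {k} hk => by
    have h1 := hev k
    have h2 : outSum a k = outSum (fun _ => (0 : ℂ)) k := outSum_congr (fun v hv => hg hv) hk
    rw [avg, hk.sum_step, hg hk, h2] at h1
    simpa [outSum] using h1
  -- It remains to give, for each nonzero non-generic point, an outward step to a generic one: (0,
  -- y) to (2y, y), (x, 0) to (x, 2x), (x, x) to (x, 3x), (-y, y) to (-y, 3y).
  have hs : ∀ (i : Fin 4) {k}, 0 < incr i k → IsGeneric (step i k) → a k = 0 :=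
    fun i k hi hk => by simpa only [parent_step hi] using hp hk
  ext ⟨x, y⟩
  simp only [Pi.zero_apply]
  by_cases hx : x = 0
  · subst hx
    by_cases hy : y = 0
    · subst hy; exact h0
    · exact hs 0 (by simp [incr, hy]) (by simp [IsGeneric, step]; omega)
  have hx2 : 0 < x * x := mul_self_pos.2 hx
  by_cases hy : y = 0
  · subst hy
    exact hs 2 (by simp [incr, hx]) (by simp [IsGeneric, step]; omega)
  by_cases hd : x = y
  · subst hd
    exact hs 2 (by simp only [incr]; nlinarith) (by simp [IsGeneric, step]; omega)
  by_cases hd' : x = -y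
  · subst hd'
    exact hs 3 (by simp only [incr]; nlinarith) (by simp [IsGeneric, step]; omega)
  exact hg ⟨hx, hy, by simp only; omega, by simp only; omega⟩

/-! ### Koopman operators in Fourier coefficients -/

/-- The Fourier basis of `L²(𝕋², ν)`. -/
noncomputable def torusBasis : HilbertBasis (Fin 2 → ℤ) ℂ (L2 ℂ) :=
  UnitAddTorus.mFourierBasis (d := Fin 2)

theorem torusBasis_coeFn (n : Fin 2 → ℤ) :
    torusBasis n =ᵐ[torusMeasure] UnitAddTorus.mFourier n := by
  have e : torusBasis n = UnitAddTorus.mFourierLp 2 n :=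
    congrFun UnitAddTorus.coe_mFourierBasis n
  rw [e]
  exact UnitAddTorus.coeFn_mFourierLp 2 n

theorem mFourier_act (A : SL(2, ℤ)) (n : Fin 2 → ℤ) (x : Torus) :
    UnitAddTorus.mFourier n (act A x) =
      UnitAddTorus.mFourier (fun j => ∑ i, n i * (A : Matrix (Fin 2) (Fin 2) ℤ) i j) x := by
  simp only [UnitAddTorus.mFourier, ContinuousMap.coe_mk, act_apply, Fin.prod_univ_two,
    Fin.sum_univ_two, fourier_apply, ← Circle.coe_mul, ← AddCircle.toCircle_add, smul_add, add_smul,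
    mul_smul]
  congr 2
  abel

theorem koopman_torusBasis (A : SL(2, ℤ)) (n : Fin 2 → ℤ) :
    koopman ℂ A (torusBasis n) =
      torusBasis (fun j => ∑ i, n i * (A : Matrix (Fin 2) (Fin 2) ℤ) i j) := by
  apply Lp.ext
  filter_upwards [koopman_coeFn ℂ A (torusBasis n), torusBasis_coeFn
    (fun j => ∑ i, n i * (A : Matrix (Fin 2) (Fin 2) ℤ) i j),
    (measurePreserving_act A).quasiMeasurePreserving.ae_eq_comp (torusBasis_coeFn n)] with x h1 h2 h3
  rw [h1, h2, ← mFourier_act]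
  exact h3

variable {𝕜 : Type*} [RCLike 𝕜]

theorem koopman_mul (A B : SL(2, ℤ)) (f : L2 𝕜) :
    koopman 𝕜 A (koopman 𝕜 B f) = koopman 𝕜 (B * A) f := by
  apply Lp.ext
  filter_upwards [koopman_coeFn 𝕜 A (koopman 𝕜 B f), koopman_coeFn 𝕜 (B * A) f,
    (measurePreserving_act A).quasiMeasurePreserving.ae_eq_comp (koopman_coeFn 𝕜 B f)]
    with x h1 h2 h3
  rw [h1, h2, act_mul]
  exact h3

theorem koopman_one (f : L2 𝕜) : koopman 𝕜 1 f = f := by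
  apply Lp.ext
  filter_upwards [koopman_coeFn 𝕜 1 f] with x h1
  rw [h1, act_one]

theorem inner_koopman (A : SL(2, ℤ)) (f g : L2 𝕜) :
    inner 𝕜 (koopman 𝕜 A f) g = inner 𝕜 f (koopman 𝕜 A⁻¹ g) := by
  rw [← LinearIsometry.inner_map_map (koopman 𝕜 A) f, koopman_mul, inv_mul_cancel, koopman_one]

theorem G_apply (f : L2 𝕜) : G 𝕜 f = (4 : 𝕜)⁻¹ •
    (koopman 𝕜 T₁ f + koopman 𝕜 T₁⁻¹ f + koopman 𝕜 T₂ f + koopman 𝕜 T₂⁻¹ f) := rfl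

theorem inner_G (f g : L2 𝕜) : inner 𝕜 (G 𝕜 f) g = inner 𝕜 f (G 𝕜 g) := by
  simp only [G_apply, inner_smul_left, inner_smul_right, inner_add_left, inner_add_right,
    inner_koopman, inv_inv, map_inv₀, map_ofNat]
  ring

/-- The Fourier coefficients of a complex-valued function, indexed by `ℤ × ℤ`. -/
noncomputable def coef (f : L2 ℂ) (k : ℤ × ℤ) : ℂ := torusBasis.repr f ![k.1, k.2]

theorem hasSum_sq_norm_coef (f : L2 ℂ) : HasSum (fun k => ‖coef f k‖ ^ 2) (‖f‖ ^ 2) := by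
  have h := torusBasis.hasSum_inner_mul_inner f f
  have h2 := (finTwoArrowEquiv ℤ).symm.hasSum_iff.2 h
  have h3 := Complex.hasSum_re h2
  convert h3 using 1
  · ext k
    simp only [Function.comp, coef, HilbertBasis.repr_apply_apply, finTwoArrowEquiv_symm_apply]
    rw [← inner_conj_symm, mul_comm, ← Complex.normSq_eq_conj_mul_self, Complex.ofReal_re,
      Complex.normSq_eq_norm_sq, RCLike.norm_conj]
  · exact norm_sq_eq_re_inner (𝕜 := ℂ) f

theorem coef_add (f g : L2 ℂ) (k : ℤ × ℤ) : coef (f + g) k = coef f k + coef g k := by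
  simp [coef]

theorem coef_smul (c : ℂ) (f : L2 ℂ) (k : ℤ × ℤ) : coef (c • f) k = c * coef f k := by
  simp [coef]

theorem coef_zero_of_mem {f : L2 ℂ} (hf : f ∈ L20 ℂ) : coef f 0 = 0 := by
  rw [L20, Submodule.mem_orthogonal_singleton_iff_inner_right] at hf
  rw [coef, HilbertBasis.repr_apply_apply, ← hf]
  congr 1
  apply Lp.ext
  filter_upwards [torusBasis_coeFn ![(0 : ℤ × ℤ).1, (0 : ℤ × ℤ).2],
    Lp.coeFn_const (p := 2) (μ := torusMeasure) (1 : ℂ)] with x h1 h2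
  rw [h1, h2]
  have : (![(0 : ℤ × ℤ).1, (0 : ℤ × ℤ).2] : Fin 2 → ℤ) = 0 := by ext i; fin_cases i <;> rfl
  rw [this, UnitAddTorus.mFourier_zero]
  rfl

/-- Composition with A sends the character n to nA (row vector), so by unitarity the coefficient at
k is read off at kA⁻¹. -/
theorem coef_koopman {A : SL(2, ℤ)} {a b c d : ℤ}
    (hA : ((A⁻¹ : SL(2, ℤ)) : Matrix (Fin 2) (Fin 2) ℤ) = !![a, b; c, d]) (f : L2 ℂ) (k : ℤ × ℤ) :
    coef (koopman ℂ A f) k = coef f (k.1 * a + k.2 * c, k.1 * b + k.2 * d) := by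
  have h := inner_koopman A⁻¹ (torusBasis ![k.1, k.2]) f
  rw [inv_inv, koopman_torusBasis, hA] at h
  rw [coef, coef, HilbertBasis.repr_apply_apply, HilbertBasis.repr_apply_apply, ← h]
  congr 2
  ext j
  fin_cases j <;> simp [Fin.sum_univ_two]

theorem coef_G (f : L2 ℂ) (k : ℤ × ℤ) : coef (G ℂ f) k = avg (coef f) k := by
  have h1 : ((T₁⁻¹ : SL(2, ℤ)) : Matrix (Fin 2) (Fin 2) ℤ) = !![1, -2; 0, 1] := by
    rw [Matrix.SpecialLinearGroup.coe_inv, T₁, Matrix.adjugate_fin_two_of]; simp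
  have h2 : ((T₂⁻¹ : SL(2, ℤ)) : Matrix (Fin 2) (Fin 2) ℤ) = !![1, 0; -2, 1] := by
    rw [Matrix.SpecialLinearGroup.coe_inv, T₂, Matrix.adjugate_fin_two_of]; simp
  have h3 : ((T₁⁻¹⁻¹ : SL(2, ℤ)) : Matrix (Fin 2) (Fin 2) ℤ) = !![1, 2; 0, 1] := by
    rw [inv_inv, T₁]
  have h4 : ((T₂⁻¹⁻¹ : SL(2, ℤ)) : Matrix (Fin 2) (Fin 2) ℤ) = !![1, 0; 2, 1] := by
    rw [inv_inv, T₂]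
  rw [G_apply, coef_smul, coef_add, coef_add, coef_add, avg, Fin.sum_univ_four, coef_koopman h1,
    coef_koopman h2, coef_koopman h3, coef_koopman h4]
  simp only [step]
  -- T₁, T₁⁻¹, T₂, T₂⁻¹ correspond to steps 3, 2, 1, 0, so the sum must be reordered.
  ring_nf

/-! ### Reduction to complex scalars -/

/-- The pointwise embedding of `L²` into the complex-valued `L²`. -/
noncomputable def complexify (f : L2 𝕜) : L2 ℂ := (RCLike.map 𝕜 ℂ).compLp f

theorem complexify_coeFn (f : L2 𝕜) :
    complexify f =ᵐ[torusMeasure] fun x => RCLike.map 𝕜 ℂ (f x) :=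
  (RCLike.map 𝕜 ℂ).coeFn_compLp f

theorem norm_complex_map (z : 𝕜) : ‖RCLike.map 𝕜 ℂ z‖ = ‖z‖ := by
  rw [← sq_eq_sq₀ (norm_nonneg _) (norm_nonneg _), Complex.sq_norm, RCLike.norm_sq_eq_def,
    Complex.normSq_apply]
  simp

theorem norm_complexify (f : L2 𝕜) : ‖complexify f‖ = ‖f‖ := by
  apply le_antisymm
  · refine Lp.norm_le_norm_of_ae_le ?_
    filter_upwards [complexify_coeFn f] with x hx
    rw [hx, norm_complex_map]
  · refine Lp.norm_le_norm_of_ae_le ?_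
    filter_upwards [complexify_coeFn f] with x hx
    rw [hx, norm_complex_map]

theorem complexify_add (f g : L2 𝕜) : complexify (f + g) = complexify f + complexify g :=
  map_add (ContinuousLinearMap.compLpₗ 2 torusMeasure (RCLike.map 𝕜 ℂ)) f g

/-- `RCLike.map` is only real-linear; this suffices because the factor 1/4 and all eigenvalues are
real. -/
theorem complexify_ofReal_smul (r : ℝ) (f : L2 𝕜) :
    complexify ((r : 𝕜) • f) = (r : ℂ) • complexify f := by
  apply Lp.ext
  filter_upwards [complexify_coeFn f, complexify_coeFn ((r : 𝕜) • f), Lp.coeFn_smul (r : 𝕜) f,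
    Lp.coeFn_smul (r : ℂ) (complexify f)] with x h1 h2 h3 h4
  rw [h2, h4, h3, Pi.smul_apply, Pi.smul_apply, h1, smul_eq_mul, smul_eq_mul,
    ← RCLike.real_smul_eq_coe_mul, map_smul, Complex.real_smul]

theorem complexify_koopman (A : SL(2, ℤ)) (f : L2 𝕜) :
    complexify (koopman 𝕜 A f) = koopman ℂ A (complexify f) := by
  apply Lp.ext
  filter_upwards [complexify_coeFn (koopman 𝕜 A f), koopman_coeFn 𝕜 A f,
    koopman_coeFn ℂ A (complexify f),
    (measurePreserving_act A).quasiMeasurePreserving.ae_eq_comp (complexify_coeFn f)]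
    with x h1 h2 h3 h4
  rw [h1, h2, h3]
  exact h4.symm

theorem complexify_G (f : L2 𝕜) : complexify (G 𝕜 f) = G ℂ (complexify f) := by
  have e : (4 : 𝕜)⁻¹ = ((4⁻¹ : ℝ) : 𝕜) := by rw [RCLike.ofReal_inv, RCLike.ofReal_ofNat]
  rw [G_apply, G_apply, e, complexify_ofReal_smul]
  simp only [complexify_add, complexify_koopman]
  simp

theorem mem_L20_iff {f : L2 𝕜} : f ∈ L20 𝕜 ↔ ∫ x, f x ∂torusMeasure = 0 := by
  rw [L20, Submodule.mem_orthogonal_singleton_iff_inner_right, L2.inner_def]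
  have : ∫ x, inner 𝕜 ((Lp.const 2 torusMeasure (1 : 𝕜) : L2 𝕜) x) (f x) ∂torusMeasure =
      ∫ x, f x ∂torusMeasure := by
    refine integral_congr_ae ?_
    filter_upwards [Lp.coeFn_const (p := 2) (μ := torusMeasure) (1 : 𝕜)] with x h
    rw [h]
    simp
  rw [this]

theorem complexify_mem {f : L2 𝕜} (hf : f ∈ L20 𝕜) : complexify f ∈ L20 ℂ := by
  rw [mem_L20_iff] at hf ⊢
  rw [integral_congr_ae (complexify_coeFn f), ContinuousLinearMap.integral_comp_comm _
    ((Lp.memLp f).integrable one_le_two), hf, map_zero]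

/-! ### Norm bound and absence of eigenfunctions -/

theorem norm_G_le {f : L2 𝕜} (hf : f ∈ L20 𝕜) : ‖G 𝕜 f‖ ≤ √3 / 2 * ‖f‖ := by
  rw [← norm_complexify, complexify_G, ← norm_complexify f]
  have h := tsum_norm_avg_sq_le (coef_zero_of_mem (complexify_mem hf))
    (hasSum_sq_norm_coef (complexify f)).summable
  simp only [← coef_G] at h
  rw [(hasSum_sq_norm_coef _).tsum_eq, (hasSum_sq_norm_coef _).tsum_eq] at h
  refine le_of_pow_le_pow_left₀ two_ne_zero (by positivity) ?_
  rw [mul_pow, div_pow, Real.sq_sqrt (by norm_num)]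
  linarith

theorem eq_zero_of_G_eq_smul {z : 𝕜} {f : L2 𝕜} (hf : f ∈ L20 𝕜) (h : G 𝕜 f = z • f) : f = 0 := by
  by_contra hne
  have hn : 0 < ‖f‖ := norm_pos_iff.2 hne
  have hz : ((RCLike.re z : ℝ) : 𝕜) = z := by
    have h1 := inner_G f f
    rw [h, inner_smul_left, inner_smul_right] at h1
    exact RCLike.conj_eq_iff_re.1 (mul_right_cancel₀ (inner_self_ne_zero.2 hne) h1)
  have hb : |RCLike.re z| ≤ √3 / 2 := by
    have h1 := norm_G_le hf
    rw [h, norm_smul, ← hz, RCLike.norm_ofReal] at h1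
    exact le_of_mul_le_mul_right h1 hn
  have hev : ∀ k, avg (coef (complexify f)) k = (RCLike.re z : ℝ) * coef (complexify f) k :=
    fun k => by rw [← coef_G, ← complexify_G, h, ← coef_smul, ← complexify_ofReal_smul, hz]
  have h0 := eq_zero_of_avg_eq hb hev (hasSum_sq_norm_coef (complexify f)).summable
    (coef_zero_of_mem (complexify_mem hf))
  have h1 := hasSum_sq_norm_coef (complexify f)
  rw [h0, norm_complexify] at h1
  simp only [Pi.zero_apply, norm_zero, ne_eq, two_ne_zero, not_false_eq_true, zero_pow] at h1
  exact hne (by simpa using h1.unique hasSum_zero)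

theorem norm_G₀_le : ‖G₀ 𝕜‖ ≤ √3 / 2 :=
  ContinuousLinearMap.opNorm_le_bound _ (by positivity) fun f => norm_G_le f.2

instance : CompleteSpace (L20 𝕜) :=
  inferInstanceAs (CompleteSpace ((𝕜 ∙ (Lp.const 2 torusMeasure (1 : 𝕜) : L2 𝕜))ᗮ : Submodule _ _))

/-! ### Spectrum of a symmetric bounded operator -/

section SelfAdjoint

variable {E : Type*} [NormedAddCommGroup E] [InnerProductSpace 𝕜 E] [CompleteSpace E]
  {T : E →L[𝕜] E}

/-- Since ⟨Tx, x⟩ is real, |⟨(z - T)x, x⟩| ≥ |im z| ‖x‖², so z - T is invertible when im z ≠ 0. -/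
theorem im_eq_zero_of_mem_spectrum (hT : ∀ x y, inner 𝕜 (T x) y = inner 𝕜 x (T y)) {z : 𝕜}
    (hz : z ∈ spectrum 𝕜 T) : RCLike.im z = 0 := by
  by_contra him
  refine hz ?_
  refine ContinuousLinearMap.isUnit_of_forall_le_norm_inner_map _ (c := ‖RCLike.im z‖₊)
    (by simpa using him) fun x => ?_
  have h1 : RCLike.im (inner 𝕜 (T x) x) = 0 := by
    rw [← RCLike.conj_eq_iff_im, inner_conj_symm, hT]
  have h2 : RCLike.im (inner 𝕜 ((algebraMap 𝕜 (E →L[𝕜] E) z - T) x) x) =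
      -RCLike.im z * ‖x‖ ^ 2 := by
    rw [Algebra.algebraMap_eq_smul_one, sub_apply, inner_sub_left, map_sub, h1,
      smul_apply, inner_smul_left, one_apply_eq_self,
      inner_self_eq_norm_sq_to_K, ← RCLike.ofReal_pow, mul_comm, RCLike.im_ofReal_mul,
      RCLike.conj_im]
    ring
  calc ‖x‖ ^ 2 * (‖RCLike.im z‖₊ : ℝ) =
        |RCLike.im (inner 𝕜 ((algebraMap 𝕜 (E →L[𝕜] E) z - T) x) x)| := by
        rw [h2, abs_mul, abs_neg, abs_of_nonneg (sq_nonneg ‖x‖), mul_comm]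
        rfl
    _ ≤ _ := RCLike.abs_im_le_norm _

/-- For z in the spectrum, hence real, a vector orthogonal to the range of T - z lies in its kernel,
which is trivial; so the range is dense. -/
theorem spectrum_eq_continuousSpectrum (hT : ∀ x y, inner 𝕜 (T x) y = inner 𝕜 x (T y))
    (hev : ∀ (z : 𝕜) x, T x = z • x → x = 0) : spectrum 𝕜 T = continuousSpectrum T := by
  have e : ∀ z : 𝕜, (fun x => T x - z • x) = ⇑(T - algebraMap 𝕜 (E →L[𝕜] E) z) := fun z => by
    ext x
    simp [Algebra.algebraMap_eq_smul_one]
  have hinj : ∀ z : 𝕜, Function.Injective ⇑(T - algebraMap 𝕜 (E →L[𝕜] E) z) := fun z => by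
    rw [injective_iff_map_eq_zero]
    intro x hx
    rw [← e, sub_eq_zero] at hx
    exact hev z x hx
  have hunit : ∀ z : 𝕜, z ∈ spectrum 𝕜 T ↔
      ¬ Function.Surjective ⇑(T - algebraMap 𝕜 (E →L[𝕜] E) z) := fun z => by
    rw [spectrum.mem_iff, ← IsUnit.neg_iff, neg_sub, ContinuousLinearMap.isUnit_iff_bijective,
      Function.Bijective, and_iff_right (hinj z)]
  ext z
  simp only [continuousSpectrum, Set.mem_ofPred_eq, e]
  refine ⟨fun hz => ⟨hinj z, ?_, (hunit z).1 hz⟩, fun hz => (hunit z).2 hz.2.2⟩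
  have hre : (starRingEnd 𝕜) z = z := RCLike.conj_eq_iff_im.2 (im_eq_zero_of_mem_spectrum hT hz)
  have h : (T - algebraMap 𝕜 (E →L[𝕜] E) z).range.topologicalClosure = ⊤ := by
    rw [Submodule.topologicalClosure_eq_top_iff, Submodule.eq_bot_iff]
    intro y hy
    refine hev z y (ext_inner_left 𝕜 fun x => ?_)
    have h1 := (Submodule.mem_orthogonal _ _).1 hy _ ⟨x, rfl⟩
    change inner 𝕜 ((T - algebraMap 𝕜 (E →L[𝕜] E) z) x) y = 0 at h1
    rw [← e, inner_sub_left, inner_smul_left, hre, hT, sub_eq_zero] at h1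
    rw [h1, inner_smul_right]
  exact (Submodule.dense_iff_topologicalClosure_eq_top.2 h)

theorem spectralRadius_le_ofReal_norm (T : E →L[𝕜] E) :
    spectralRadius 𝕜 T ≤ ENNReal.ofReal ‖T‖ := by
  refine iSup₂_le fun z hz => ?_
  rw [← enorm_eq_nnnorm, ← ofReal_norm]
  refine ENNReal.ofReal_le_ofReal ((spectrum.norm_le_norm_mul_of_mem hz).trans ?_)
  -- Only ‖1‖ ≤ 1 is used, since E may be trivial.
  exact mul_le_of_le_one_right (norm_nonneg T) ContinuousLinearMap.norm_id_le

end SelfAdjoint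

theorem inner_G₀ (f g : L20 𝕜) : inner 𝕜 (G₀ 𝕜 f) g = inner 𝕜 f (G₀ 𝕜 g) :=
  inner_G (f : L2 𝕜) g

theorem eq_zero_of_G₀_eq_smul (z : 𝕜) (f : L20 𝕜) (h : G₀ 𝕜 f = z • f) : f = 0 :=
  Subtype.ext (eq_zero_of_G_eq_smul f.2 (congrArg Subtype.val h))

end TorusExpander

theorem mainTheorem4 (𝕜 : Type*) [RCLike 𝕜] :
    (∀ (z : 𝕜) (f : TorusExpander.L2 𝕜), f ∈ TorusExpander.L20 𝕜 →
        TorusExpander.G 𝕜 f = z • f → f = 0) ∧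
      (∀ z ∈ spectrum 𝕜 (TorusExpander.G₀ 𝕜), RCLike.im z = 0) ∧
      spectrum 𝕜 (TorusExpander.G₀ 𝕜) =
        TorusExpander.continuousSpectrum (TorusExpander.G₀ 𝕜) ∧
      spectralRadius 𝕜 (TorusExpander.G₀ 𝕜) ≤ ENNReal.ofReal (√3 / 2) ∧
      ‖TorusExpander.G₀ 𝕜‖ ≤ √3 / 2 :=
  ⟨fun _ _ hf h => TorusExpander.eq_zero_of_G_eq_smul hf h,
    fun _ hz => TorusExpander.im_eq_zero_of_mem_spectrum TorusExpander.inner_G₀ hz,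
    TorusExpander.spectrum_eq_continuousSpectrum TorusExpander.inner_G₀
      TorusExpander.eq_zero_of_G₀_eq_smul,
    (TorusExpander.spectralRadius_le_ofReal_norm _).trans
      (ENNReal.ofReal_le_ofReal TorusExpander.norm_G₀_le), TorusExpander.norm_G₀_le⟩
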